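/- Let $s(n,k)$ denote the (signed) Stirling numbers of the first kind, given by $\frac{[\ln(1+x)]^k}{k!}=\sum_{n\ge k}s(n,k)\frac{x^n}{n!}$, and for integers $k\ge1$, $m\ge2$ put $$Q(k,m)=\sum_{\ell=0}^{m}\binom{k+\ell-1}{k-1}\,s(k+m-1,k+\ell-1)\Bigl(\frac{k+m-2}{2}\Bigr)^{\ell}.$$ For integers $m\ge k\ge1$ let $$B_{m,k}(x_1,\dots,x_{m-k+1})=\sum\frac{m!}{\prod_{i=1}^{m-k+1}\ell_i!}\prod_{i=1}^{m-k+1}\Bigl(\frac{x_i}{i!}\Bigr)^{\ell_i}$$ be the partial Bell polynomial, where the sum runs over all tuples of integers $\ell_1,\dots,\ell_{m-k+1}\ge0$ with $\sum_i i\,\ell_i=m$ and $\sum_i\ell_i=k$. Let $f(x)=\frac{(\arccos x)^2}{2(1-x)}$. Then $f$ is infinitely differentiable on $(-1,1)$ and, for every $n\ge1$, the limit $f^{(n)}(1^-):=\lim_{x\to1^-}f^{(n)}(x)$ exists in $\mathbb{R}$. For all integers $m\ge k\ge1$, $$B_{m,k}\bigl(f'(1^-),f''(1^-),\dots,f^{(m-k+1)}(1^-)\bigr)=2^k\,B_{m,k}(b_1,b_2,\dots,b_{m-k+1}),\qquad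 b_n=\frac{(2n)!!}{(2n+2)!}\,Q(2,2n),$$ where $b_1=-\frac1{12}$, $b_2=\frac2{45}$, $b_3=-\frac3{70}$, $b_4=\frac{32}{525}$, $b_5=-\frac{80}{693}$, and $$B_{m,k}\bigl(f'(1^-),\dots,f^{(m-k+1)}(1^-)\bigr)=(-2)^k\,[2(m-k)]!!\,\binom mk\sum_{j=1}^{k}(-1)^j(2j)!\binom kj\frac{Q(2j,2m)}{(2j+2m)!}.$$ -/

import Mathlib

open scoped Nat Topology ContDiff

/-- The (signed) Stirling numbers of the first kind `s(n, k)`, obtained from the unsigned ones of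
Mathlib by the sign `(-1) ^ (n - k)`; equivalently
`log (1 + x) ^ k / k! = ∑ n ≥ k, s(n, k) * x ^ n / n!`. -/
def signedStirlingFirst (n k : ℕ) : ℤ :=
  (-1) ^ (n + k) * (Nat.stirlingFirst n k : ℤ)

/-- `Q(k, m) = ∑_{ℓ = 0}^{m} C(k+ℓ-1, k-1) s(k+m-1, k+ℓ-1) ((k+m-2)/2)^ℓ` for `k ≥ 1`, `m ≥ 2`. -/
noncomputable def stirlingQ (k m : ℕ) : ℝ :=
  ∑ l ∈ Finset.range (m + 1),
    ((k + l - 1).choose (k - 1) : ℝ) * (signedStirlingFirst (k + m - 1) (k + l - 1) : ℝ) *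
      (((k : ℝ) + (m : ℝ) - 2) / 2) ^ l

/-- The partial Bell polynomial `B_{n,k}(x 1, x 2, …, x (n - k + 1))`. The summation variable `l`
runs over the families `(l 0, …, l (n - k))` of natural numbers with `∑ i, l i = k` and
`∑ i, (i + 1) * l i = n`; the entry `l i` is the exponent of `x (i + 1)`. -/
noncomputable def partialBell (n k : ℕ) (x : ℕ → ℝ) : ℝ :=
  ∑ l ∈ (Finset.piAntidiag (Finset.univ : Finset (Fin (n - k + 1))) k).filter
      (fun l => ∑ i : Fin (n - k + 1), ((i : ℕ) + 1) * l i = n),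
    (n ! : ℝ) / (∏ i, ((l i)! : ℝ)) *
      ∏ i : Fin (n - k + 1), (x ((i : ℕ) + 1) / (((i : ℕ) + 1)! : ℝ)) ^ l i

/-- The function `(arccos x)² / (2 (1 - x))`. -/
noncomputable def arccosSqQuot (x : ℝ) : ℝ :=
  Real.arccos x ^ 2 / (2 * (1 - x))

/-- The value at `x = 1⁻` of the `n`-th derivative of `(arccos x)² / (2 (1 - x))`, that is, the
limit of the `n`-th derivative as `x` tends to `1` from the left. -/
noncomputable def arccosSqQuotDeriv (n : ℕ) : ℝ :=
  Filter.limUnder (𝓝[<] (1 : ℝ)) (iteratedDeriv n arccosSqQuot)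

/-- The sequence `(2n)!! / (2n+2)! * Q(2, 2n)`, which starts `-1/12, 2/45, -3/70, …` at `n = 1`. -/
noncomputable def bellArg (n : ℕ) : ℝ :=
  ((2 * n)‼ : ℝ) / ((2 * n + 2)! : ℝ) * stirlingQ 2 (2 * n)

/-!
In the variable `y = arccos x` the Chebyshev operator `(1 - x²) ∂² - x ∂` is `∂²`, so the functions
`arccos x ^ (2 * j) / (2 * j)!` are successive preimages of `1`. On power series in `x - 1` the
operator becomes a two-term recurrence, which is also that of the central factorial numbers, and
which determines a series up to its constant term; thus the `j`-th power of the expansion of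
`arccos x ^ 2 / 2` is `(2 * j)! / 2 ^ j` times that of `arccos x ^ (2 * j) / (2 * j)!`. The sum
`Q(2j, 2m)` is a central factorial number because it arises by expanding the falling factorial
`x (x - 1) ⋯ (x - 2p)` about its centre `p`. Finally, the partial Bell polynomial of the derivatives
of a power series `A` is `m! / k!` times the coefficient of order `m` in `(A - A(0)) ^ k`, which the
binomial theorem reduces to the powers of `A`.
-/

section CentralFactorial

open Polynomial

variable (R : Type*) [CommRing R]

theorem coeff_descPochhammer (n k : ℕ) :
    (descPochhammer R n).coeff k = (signedStirlingFirst n k : R) := by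
  induction n generalizing k with
  | zero => cases k <;> simp [signedStirlingFirst, coeff_one]
  | succ n ih =>
    rw [descPochhammer_succ_right, mul_sub, coeff_sub, ← C_eq_natCast, coeff_mul_C, ih]
    cases k with
    | zero => cases n <;> simp [signedStirlingFirst]
    | succ k =>
      rw [coeff_mul_X, ih]
      simp only [signedStirlingFirst, Nat.stirlingFirst_succ_succ]
      push_cast
      ring

variable {R} in
theorem coeff_taylor_descPochhammer {n j : ℕ} (hj : j ≤ n) (r : R) :
    (taylor r (descPochhammer R n)).coeff j =
      ∑ l ∈ Finset.range (n + 1 - j),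
        ((j + l).choose j : R) * (signedStirlingFirst n (j + l) : R) * r ^ l := by
  have hdeg : (descPochhammer R n).natDegree ≤ n := natDegree_le_iff_coeff_eq_zero.2 fun k hk => by
    simp [coeff_descPochhammer, signedStirlingFirst, Nat.stirlingFirst_eq_zero_of_lt hk]
  have hdeg' : (hasseDeriv j (descPochhammer R n)).natDegree < n + 1 - j := by
    have := natDegree_hasseDeriv_le (descPochhammer R n) j
    omega
  rw [taylor_coeff, eval_eq_sum_range' hdeg']
  refine Finset.sum_congr rfl fun l _ => ?_
  rw [hasseDeriv_coeff, coeff_descPochhammer, add_comm l j]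

/-- The polynomial `∏_{i < n} (X - i²)`. Its coefficients are the central factorial numbers
`t(2n, 2k)` of the first kind. -/
noncomputable def centralFactorialPoly (n : ℕ) : R[X] :=
  ∏ i ∈ Finset.range n, (X - C ((i : R) ^ 2))

theorem centralFactorialPoly_succ (n : ℕ) :
    centralFactorialPoly R (n + 1) = centralFactorialPoly R n * (X - C ((n : R) ^ 2)) :=
  Finset.prod_range_succ _ _

theorem coeff_centralFactorialPoly_succ_zero (n : ℕ) :
    (centralFactorialPoly R (n + 1)).coeff 0 = 0 := by
  simp [centralFactorialPoly, Finset.prod_range_succ', mul_coeff_zero]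

theorem coeff_centralFactorialPoly_succ_succ (n k : ℕ) :
    (centralFactorialPoly R (n + 1)).coeff (k + 1) =
      (centralFactorialPoly R n).coeff k -
        (n : R) ^ 2 * (centralFactorialPoly R n).coeff (k + 1) := by
  rw [centralFactorialPoly_succ, mul_sub, coeff_sub, coeff_mul_X, coeff_mul_C, mul_comm]

theorem coeff_centralFactorialPoly_succ_one (n : ℕ) :
    (centralFactorialPoly R (n + 1)).coeff 1 = (-1) ^ n * (n ! : R) ^ 2 := by
  induction n with
  | zero => simp [centralFactorialPoly]
  | succ n ih =>
    rw [coeff_centralFactorialPoly_succ_succ, ih, coeff_centralFactorialPoly_succ_zero,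
      Nat.factorial_succ]
    push_cast
    ring

-- Shifted to its centre, `x (x - 1) ⋯ (x - 2p)` becomes `∏_{|i| ≤ p} (x - i)`, and the factors
-- `x - i` and `x + i` pair up.
theorem X_mul_taylor_descPochhammer (p : ℕ) :
    X * taylor (p : R) (descPochhammer R (2 * p + 1)) =
      expand R 2 (centralFactorialPoly R (p + 1)) := by
  induction p with
  | zero => simp [centralFactorialPoly, sq]
  | succ p ih =>
    have hshift : (X + C ((p + 1 : ℕ) : R) - 1 : R[X]) = X + C (p : R) := by
      simp only [Nat.cast_add, Nat.cast_one, C_add, C_1]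
      ring
    rw [centralFactorialPoly_succ, map_mul, ← ih, show 2 * (p + 1) + 1 = 2 * p + 1 + 1 + 1 by ring,
      descPochhammer_succ_left, descPochhammer_succ_right]
    simp only [taylor_apply, mul_comp, comp_assoc, sub_comp, X_comp, one_comp, natCast_comp,
      map_sub, expand_X, expand_C, hshift]
    simp only [C_pow, C_eq_natCast]
    push_cast
    ring

theorem stirlingQ_two_mul {j : ℕ} (hj : 1 ≤ j) (m : ℕ) :
    stirlingQ (2 * j) (2 * m) = (centralFactorialPoly ℝ (m + j)).coeff j := by
  obtain ⟨i, rfl⟩ := Nat.exists_eq_add_of_le' hj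
  have hcoeff : (taylor ((m + i : ℕ) : ℝ) (descPochhammer ℝ (2 * (m + i) + 1))).coeff (2 * i + 1) =
      (centralFactorialPoly ℝ (m + (i + 1))).coeff (i + 1) := by
    rw [← coeff_X_mul, X_mul_taylor_descPochhammer, show 2 * i + 1 + 1 = (i + 1) * 2 by ring,
      coeff_expand_mul two_pos, add_assoc]
  rw [← hcoeff, coeff_taylor_descPochhammer (by omega), stirlingQ,
    show 2 * (m + i) + 1 + 1 - (2 * i + 1) = 2 * m + 1 by omega]
  refine Finset.sum_congr rfl fun l _ => ?_
  rw [show 2 * (i + 1) + l - 1 = 2 * i + 1 + l by omega,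
    show 2 * (i + 1) - 1 = 2 * i + 1 by omega,
    show 2 * (i + 1) + 2 * m - 1 = 2 * (m + i) + 1 by omega]
  congr 2
  push_cast
  ring

end CentralFactorial

section ChebyshevOperator

open PowerSeries

section CommRing

variable {R : Type*} [CommRing R]

/-- The operator `f ↦ -(2X + X²) f'' - (1 + X) f'`. It is the Chebyshev operator
`(1 - x²) ∂² - x ∂` written in the variable `X = x - 1`, and becomes `∂²` in the variable
`y = arccos x`. -/
noncomputable def chebyshevOp : R⟦X⟧ →ₗ[R] R⟦X⟧ :=
  -(LinearMap.mulLeft R (2 * X + X ^ 2) ∘ₗ (d⁄dX R).toLinearMap ∘ₗ (d⁄dX R).toLinearMap) -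
    LinearMap.mulLeft R (1 + X) ∘ₗ (d⁄dX R).toLinearMap

theorem chebyshevOp_apply (f : R⟦X⟧) :
    chebyshevOp f = -((2 * X + X ^ 2) * d⁄dX R (d⁄dX R f)) - (1 + X) * d⁄dX R f :=
  rfl

theorem chebyshevOp_eq (f : R⟦X⟧) :
    chebyshevOp f =
      -(X * (d⁄dX R (d⁄dX R f) + d⁄dX R (d⁄dX R f) + X * d⁄dX R (d⁄dX R f)) +
        (d⁄dX R f + X * d⁄dX R f)) := by
  rw [chebyshevOp_apply]
  ring

theorem coeff_chebyshevOp (f : R⟦X⟧) (n : ℕ) :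
    coeff n (chebyshevOp f) =
      -((n + 1) * (2 * n + 1) * coeff (n + 1) f) - (n : R) ^ 2 * coeff n f := by
  rw [chebyshevOp_eq]
  rcases n with _ | _ | n
  · simp [coeff_derivative, coeff_zero_X_mul, -coeff_zero_eq_constantCoeff]
  · simp only [map_neg, map_add, coeff_succ_X_mul, coeff_zero_X_mul, coeff_derivative]
    push_cast
    ring
  · simp only [map_neg, map_add, coeff_succ_X_mul, coeff_derivative]
    push_cast
    ring

end CommRing

variable {K : Type*} [Field K]

variable (K) in
/-- The expansion of `arccos x ^ (2 * j) / (2 * j)!` in powers of `X = x - 1`. -/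
noncomputable def arccosPowSeries (j : ℕ) : K⟦X⟧ :=
  PowerSeries.mk fun n =>
    (-1) ^ j * 2 ^ n * (centralFactorialPoly K n).coeff j / ((2 * n)! : K)

theorem arccosPowSeries_zero : arccosPowSeries K 0 = 1 := by
  ext n
  cases n with
  | zero => simp [arccosPowSeries, centralFactorialPoly]
  | succ n => simp [arccosPowSeries, coeff_centralFactorialPoly_succ_zero, coeff_one]

theorem constantCoeff_arccosPowSeries_succ (j : ℕ) :
    constantCoeff (arccosPowSeries K (j + 1)) = 0 := by
  rw [← coeff_zero_eq_constantCoeff_apply]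
  simp [arccosPowSeries, centralFactorialPoly, Polynomial.coeff_one]

variable (K) in
/-- The expansion of `arccos x ^ 2 / (2 * (1 - x))` in powers of `X = x - 1`. -/
noncomputable def arccosSqQuotSeries : K⟦X⟧ :=
  PowerSeries.mk fun n => -coeff (n + 1) (arccosPowSeries K 1)

theorem coeff_arccosSqQuotSeries (n : ℕ) :
    coeff n (arccosSqQuotSeries K) =
      2 ^ (n + 1) * (centralFactorialPoly K (n + 1)).coeff 1 / ((2 * n + 2)! : K) := by
  simp [arccosSqQuotSeries, arccosPowSeries, neg_div, mul_add]

theorem arccosPowSeries_one_eq : arccosPowSeries K 1 = X * -arccosSqQuotSeries K := by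
  ext n
  cases n with
  | zero => simp [constantCoeff_arccosPowSeries_succ 0]
  | succ n => simp [coeff_succ_X_mul, arccosSqQuotSeries]

variable [CharZero K]

theorem eq_of_chebyshevOp_eq {f g : K⟦X⟧} (h : chebyshevOp f = chebyshevOp g)
    (h0 : constantCoeff f = constantCoeff g) : f = g := by
  ext n
  induction n with
  | zero => simpa using h0
  | succ n ih =>
    have hn := congrArg (coeff n) h
    rw [coeff_chebyshevOp, coeff_chebyshevOp, ih, sub_left_inj, neg_inj] at hn
    exact mul_left_cancel₀ (mod_cast (by positivity : (n + 1) * (2 * n + 1) ≠ 0)) hn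

-- First integral: the derivative of the left side is `2 f' * chebyshevOp f`.
theorem mul_derivative_sq_of_chebyshevOp_eq_one {f : K⟦X⟧} (h : chebyshevOp f = 1)
    (h0 : constantCoeff f = 0) : -(2 * X + X ^ 2) * (d⁄dX K f) ^ 2 = 2 * f := by
  rw [chebyshevOp_apply] at h
  refine derivative.ext ?_ (by simp [h0])
  have h2 : d⁄dX K (2 : K⟦X⟧) = 0 := by rw [← map_ofNat (C (R := K)) 2, derivative_C]
  simp only [Derivation.leibniz, derivative_pow, map_neg, map_add, derivative_X, h2, smul_eq_mul]
  linear_combination (2 * d⁄dX K f) * h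

theorem chebyshevOp_pow_succ {f : K⟦X⟧} (h : chebyshevOp f = 1) (h0 : constantCoeff f = 0)
    (j : ℕ) : chebyshevOp (f ^ (j + 1)) = (((j + 1) * (2 * j + 1) : ℕ) : K) • f ^ j := by
  have hsq := mul_derivative_sq_of_chebyshevOp_eq_one h h0
  rw [smul_eq_C_mul, map_natCast]
  cases j with
  | zero => simpa using h
  | succ j =>
    have hN (n : ℕ) : d⁄dX K (n : K⟦X⟧) = 0 := by
      rw [← map_natCast (C (R := K)) n, derivative_C]
    rw [chebyshevOp_apply] at h ⊢
    simp only [Derivation.leibniz, derivative_pow, smul_eq_mul, hN, Nat.add_sub_cancel]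
    push_cast
    linear_combination ((j : K⟦X⟧) + 2) * f ^ (j + 1) * h +
      ((j : K⟦X⟧) + 2) * (j + 1) * f ^ j * hsq

theorem chebyshevOp_arccosPowSeries_succ (j : ℕ) :
    chebyshevOp (arccosPowSeries K (j + 1)) = arccosPowSeries K j := by
  ext n
  have h0 : ((2 * n)! : K) ≠ 0 := mod_cast (2 * n).factorial_ne_zero
  have h1 : (n * 2 + 1 : K) ≠ 0 := mod_cast (n * 2).succ_ne_zero
  have h2 : (n + 1 : K) ≠ 0 := n.cast_add_one_ne_zero
  rw [coeff_chebyshevOp]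
  simp only [arccosPowSeries, coeff_mk, coeff_centralFactorialPoly_succ_succ]
  rw [show 2 * (n + 1) = 2 * n + 1 + 1 by ring, Nat.factorial_succ, Nat.factorial_succ]
  push_cast
  rw [show (2 * n + 1 + 1 : K) = 2 * (n + 1) by ring]
  field_simp
  ring

theorem chebyshevOp_arccosPowSeries_one : chebyshevOp (arccosPowSeries K 1) = 1 := by
  rw [chebyshevOp_arccosPowSeries_succ, arccosPowSeries_zero]

theorem arccosPowSeries_one_pow (j : ℕ) :
    arccosPowSeries K 1 ^ j = ((2 * j)! / 2 ^ j : K) • arccosPowSeries K j := by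
  induction j with
  | zero => simp [arccosPowSeries_zero]
  | succ j ih =>
    refine eq_of_chebyshevOp_eq ?_ ?_
    · rw [chebyshevOp_pow_succ chebyshevOp_arccosPowSeries_one
        (constantCoeff_arccosPowSeries_succ 0), ih, map_smul, chebyshevOp_arccosPowSeries_succ,
        smul_smul, show 2 * (j + 1) = 2 * j + 1 + 1 by ring, Nat.factorial_succ, Nat.factorial_succ]
      congr 1
      push_cast
      field_simp
      ring
    · simp [constantCoeff_arccosPowSeries_succ]

theorem constantCoeff_arccosSqQuotSeries : constantCoeff (arccosSqQuotSeries K) = 1 := by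
  rw [← coeff_zero_eq_constantCoeff_apply, coeff_arccosSqQuotSeries,
    coeff_centralFactorialPoly_succ_one]
  simp

theorem coeff_arccosSqQuotSeries_pow (j m : ℕ) :
    coeff m (arccosSqQuotSeries K ^ j) =
      2 ^ m * ((2 * j)! : K) * (centralFactorialPoly K (m + j)).coeff j /
        ((2 * j + 2 * m)! : K) := by
  have h := congrArg (coeff (m + j)) (arccosPowSeries_one_pow (K := K) j)
  rw [arccosPowSeries_one_eq, mul_pow, coeff_X_pow_mul, neg_pow, coeff_smul, arccosPowSeries,
    coeff_mk, show (-1 : K⟦X⟧) ^ j = C ((-1 : K) ^ j) by simp, coeff_C_mul] at h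
  refine mul_left_cancel₀ (pow_ne_zero j (neg_ne_zero.2 (one_ne_zero (α := K)))) ?_
  rw [h, mul_add 2 m j, add_comm (2 * m), smul_eq_mul, pow_add]
  field_simp

end ChebyshevOperator

section SeriesSums

open PowerSeries

variable {R : Type*} [CommRing R] [TopologicalSpace R] {f g : R⟦X⟧} {t r s : R}

/-- The formal power series `f`, evaluated at `t`, converges (unconditionally) to `s`. -/
def SeriesHasSum (f : R⟦X⟧) (t s : R) : Prop :=
  HasSum (fun n => coeff n f * t ^ n) s

theorem seriesHasSum_one (t : R) : SeriesHasSum 1 t 1 := by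
  refine (hasSum_ite_eq 0 (1 : R)).congr_fun fun n => ?_
  cases n <;> simp [coeff_one]

variable [IsTopologicalRing R]

theorem SeriesHasSum.add (hf : SeriesHasSum f t r) (hg : SeriesHasSum g t s) :
    SeriesHasSum (f + g) t (r + s) := by
  simpa [SeriesHasSum, add_mul] using HasSum.add hf hg

theorem SeriesHasSum.neg (hf : SeriesHasSum f t s) : SeriesHasSum (-f) t (-s) := by
  simpa [SeriesHasSum] using HasSum.neg hf

theorem SeriesHasSum.X_mul (hf : SeriesHasSum f t s) : SeriesHasSum (X * f) t (t * s) := by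
  rw [SeriesHasSum, ← hasSum_nat_add_iff' 1]
  simpa [coeff_succ_X_mul, pow_succ', mul_left_comm] using HasSum.mul_left t hf

theorem SeriesHasSum.chebyshevOp (hr : SeriesHasSum (d⁄dX R f) t r)
    (hs : SeriesHasSum (d⁄dX R (d⁄dX R f)) t s) :
    SeriesHasSum (chebyshevOp f) t (-(2 * t + t ^ 2) * s - (1 + t) * r) := by
  rw [chebyshevOp_eq]
  convert! (((hs.add hs).add hs.X_mul).X_mul.add (hr.add hr.X_mul)).neg using 1
  ring

end SeriesSums

section ScalarSeries

open PowerSeries FormalMultilinearSeries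

variable {𝕜 : Type*} [NontriviallyNormedField 𝕜] {F : 𝕜 → 𝕜} {f : 𝕜⟦X⟧} {a : 𝕜} {r : ENNReal}

/-- The formal power series `f`, regarded as the formal multilinear series in terms of which
Mathlib expresses analyticity. -/
noncomputable def scalarSeries (f : 𝕜⟦X⟧) : FormalMultilinearSeries 𝕜 𝕜 𝕜 :=
  ofScalars 𝕜 fun n => coeff n f

theorem coeff_scalarSeries (f : 𝕜⟦X⟧) (n : ℕ) : (scalarSeries f).coeff n = coeff n f :=
  coeff_ofScalars

theorem eq_scalarSeries {p : FormalMultilinearSeries 𝕜 𝕜 𝕜} (h : ∀ n, p.coeff n = coeff n f) :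
    p = scalarSeries f := by
  refine FormalMultilinearSeries.ext fun n => ?_
  rw [← mkPiRing_coeff_eq p, ← mkPiRing_coeff_eq (scalarSeries f), h, coeff_scalarSeries]

theorem seriesHasSum_of_hasFPowerSeriesOnBall (h : HasFPowerSeriesOnBall F (scalarSeries f) a r)
    {x : 𝕜} (hx : x ∈ Metric.eball a r) : SeriesHasSum f (x - a) (F x) := by
  simpa only [scalarSeries, SeriesHasSum, ofScalars_apply_eq, smul_eq_mul] using h.hasSum_sub hx

theorem hasFPowerSeriesOnBall_deriv [CompleteSpace 𝕜]
    (h : HasFPowerSeriesOnBall F (scalarSeries f) a r) :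
    HasFPowerSeriesOnBall (deriv F) (scalarSeries (d⁄dX 𝕜 f)) a r := by
  have hseries : (ContinuousLinearMap.apply 𝕜 𝕜 (1 : 𝕜)).compFormalMultilinearSeries
      (scalarSeries f).derivSeries = scalarSeries (d⁄dX 𝕜 f) := by
    refine eq_scalarSeries fun n => ?_
    refine ((scalarSeries f).derivSeries_coeff_one n).trans ?_
    rw [coeff_scalarSeries, coeff_derivative, nsmul_eq_mul, mul_comm]
    push_cast
    rfl
  exact hseries ▸ (ContinuousLinearMap.apply 𝕜 𝕜 (1 : 𝕜)).comp_hasFPowerSeriesOnBall h.fderiv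

theorem seriesHasSum_chebyshevOp [CompleteSpace 𝕜]
    (h : HasFPowerSeriesOnBall F (scalarSeries f) 1 r) {x : 𝕜} (hx : x ∈ Metric.eball 1 r) :
    SeriesHasSum (chebyshevOp f) (x - 1) ((1 - x ^ 2) * deriv (deriv F) x - x * deriv F x) := by
  have h' := hasFPowerSeriesOnBall_deriv h
  convert! (seriesHasSum_of_hasFPowerSeriesOnBall h' hx).chebyshevOp
    (seriesHasSum_of_hasFPowerSeriesOnBall (hasFPowerSeriesOnBall_deriv h') hx) using 1
  ring

theorem iteratedDeriv_eq_factorial_mul_coeff [CompleteSpace 𝕜]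
    {p : FormalMultilinearSeries 𝕜 𝕜 𝕜} (h : HasFPowerSeriesAt F p a) (n : ℕ) :
    iteratedDeriv n F a = n ! * p.coeff n := by
  obtain ⟨r, hr⟩ := h
  rw [iteratedDeriv_eq_iteratedFDeriv, ← hr.factorial_smul 1 n, nsmul_eq_mul,
    apply_eq_pow_smul_coeff, one_pow, one_smul]

end ScalarSeries

theorem tendsto_iteratedDeriv_of_eventuallyEq {E : Type*} [NormedAddCommGroup E]
    [NormedSpace ℝ E] [CompleteSpace E] {f g : ℝ → E} {a : ℝ} (hg : AnalyticAt ℝ g a)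
    (hfg : f =ᶠ[𝓝[<] a] g) (n : ℕ) :
    Filter.Tendsto (iteratedDeriv n f) (𝓝[<] a) (𝓝 (iteratedDeriv n g a)) := by
  have hcont : ContinuousAt (iteratedDeriv n g) a := by
    rw [iteratedDeriv_eq_iterate]
    exact (hg.iterated_deriv n).continuousAt
  refine (hcont.tendsto.mono_left nhdsWithin_le_nhds).congr' ?_
  have hnear : ∀ᶠ x in 𝓝[<] a, f =ᶠ[𝓝 x] g := by
    filter_upwards [eventually_eventually_nhdsWithin.2 hfg, self_mem_nhdsWithin] with x hx hxa
    rwa [isOpen_Iio.nhdsWithin_eq hxa] at hx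
  exact hnear.mono fun x hx => (hx.iteratedDeriv_eq n).symm

section Arccos

open Set Real PowerSeries

theorem eqOn_Ioo_of_hasDerivAt {f g f' : ℝ → ℝ} {r : ℝ}
    (hf : ∀ y ∈ Ioo (-r) r, HasDerivAt f (f' y) y) (hg : ∀ y ∈ Ioo (-r) r, HasDerivAt g (f' y) y)
    (h0 : f 0 = g 0) : EqOn f g (Ioo (-r) r) := by
  intro y hy
  have hr : 0 < r := by linarith [hy.1, hy.2]
  exact isOpen_Ioo.eqOn_of_deriv_eq isPreconnected_Ioo
    (fun z hz => (hf z hz).differentiableAt.differentiableWithinAt)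
    (fun z hz => (hg z hz).differentiableAt.differentiableWithinAt)
    (fun z hz => (hf z hz).deriv.trans (hg z hz).deriv.symm) (by simpa using hr) h0 hy

theorem cos_mem_Ioc {y : ℝ} (hy : y ∈ Ioo (-π) π) : cos y ∈ Ioc (-1) 1 := by
  refine ⟨?_, cos_le_one y⟩
  rw [← cos_pi, ← cos_abs y]
  exact cos_lt_cos_of_nonneg_of_le_pi (abs_nonneg y) le_rfl (abs_lt.2 hy)

theorem eq_arccos_sq_div_two {F : ℝ → ℝ} (hF : ∀ x ∈ Ioc (-1) 1, DifferentiableAt ℝ F x)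
    (hF' : ∀ x ∈ Ioc (-1) 1, DifferentiableAt ℝ (deriv F) x)
    (hode : ∀ x ∈ Ioc (-1) 1, (1 - x ^ 2) * deriv (deriv F) x - x * deriv F x = 1) (h1 : F 1 = 0)
    {x : ℝ} (hx : x ∈ Ioc (-1) 1) : F x = arccos x ^ 2 / 2 := by
  have hderiv : EqOn (fun y => deriv F (cos y) * -sin y) id (Ioo (-π) π) := by
    refine eqOn_Ioo_of_hasDerivAt (f' := fun _ => 1) (fun y hy => ?_)
      (fun y _ => hasDerivAt_id y) (by simp)
    have hy' := cos_mem_Ioc hy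
    refine (((hF' _ hy').hasDerivAt.comp y (hasDerivAt_cos y)).mul
      (hasDerivAt_sin y).neg).congr_deriv ?_
    simp only [Function.comp_apply, Pi.neg_apply]
    linear_combination hode _ hy' + deriv (deriv F) (cos y) * sin_sq_add_cos_sq y
  have hcos : EqOn (fun y => F (cos y)) (fun y => y ^ 2 / 2) (Ioo (-π) π) := by
    refine eqOn_Ioo_of_hasDerivAt (f' := id) (fun y hy => ?_) (fun y _ => ?_) (by simpa using h1)
    · exact ((hF _ (cos_mem_Ioc hy)).hasDerivAt.comp y (hasDerivAt_cos y)).congr_deriv (hderiv hy)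
    · simpa using (hasDerivAt_pow 2 y).div_const 2
  have hpi : arccos x ∈ Ioo (-π) π :=
    ⟨by linarith [arccos_nonneg x, pi_pos], by simpa using arccos_lt_arccos le_rfl hx.1 hx.2⟩
  simpa [cos_arccos hx.1.le hx.2] using hcos hpi

theorem abs_coeff_mul_two_pow_le {f : ℝ⟦X⟧} (h : chebyshevOp f = 1) (h0 : constantCoeff f = 0)
    (n : ℕ) : |coeff n f| * 2 ^ n ≤ 2 := by
  have hrec (n : ℕ) := coeff_chebyshevOp f n
  simp only [h, coeff_one] at hrec
  induction n with
  | zero => simp [h0]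
  | succ n ih =>
    rcases n.eq_zero_or_pos with rfl | hn
    · have : coeff 1 f = -1 := by simpa [neg_eq_iff_eq_neg] using (hrec 0).symm
      simp [this]
    have hpos : 0 < ((n + 1) * (2 * n + 1) : ℝ) := by positivity
    have habs : ((n + 1) * (2 * n + 1) : ℝ) * |coeff (n + 1) f| = n ^ 2 * |coeff n f| := by
      have hn' := hrec n
      rw [if_neg hn.ne', eq_comm, sub_eq_zero] at hn'
      simpa only [abs_neg, abs_mul _ (coeff _ f), abs_of_pos hpos, abs_sq] using congrArg abs hn'
    refine le_of_mul_le_mul_left ?_ hpos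
    calc ((n + 1) * (2 * n + 1) : ℝ) * (|coeff (n + 1) f| * 2 ^ (n + 1))
        = 2 * n ^ 2 * (|coeff n f| * 2 ^ n) := by linear_combination 2 ^ (n + 1) * habs
      _ ≤ 2 * n ^ 2 * 2 := by gcongr
      _ ≤ (n + 1) * (2 * n + 1) * 2 := by nlinarith [(n.cast_nonneg : (0 : ℝ) ≤ n)]

theorem exists_hasFPowerSeriesOnBall_arccosPowSeries_one :
    ∃ F : ℝ → ℝ, HasFPowerSeriesOnBall F (scalarSeries (arccosPowSeries ℝ 1)) 1 2 := by
  set p := scalarSeries (arccosPowSeries ℝ 1) with hp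
  have hr : (2 : ENNReal) ≤ p.radius := by
    refine p.le_radius_of_bound (r := 2) 2 fun n => ?_
    rw [hp, scalarSeries, FormalMultilinearSeries.ofScalars_norm]
    exact abs_coeff_mul_two_pow_le chebyshevOp_arccosPowSeries_one
      (constantCoeff_arccosPowSeries_succ 0) n
  refine ⟨fun x => p.sum (x - 1), ?_⟩
  simpa using! ((p.hasFPowerSeriesOnBall (two_pos.trans_le hr)).mono two_pos hr).comp_sub 1

theorem eq_arccos_sq_of_hasFPowerSeriesOnBall {F : ℝ → ℝ}
    (hF : HasFPowerSeriesOnBall F (scalarSeries (arccosPowSeries ℝ 1)) 1 2) {x : ℝ}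
    (hx : x ∈ Ioc (-1) 1) : F x = arccos x ^ 2 / 2 := by
  have hball {z : ℝ} (hz : z ∈ Ioc (-1) 1) : z ∈ Metric.eball (1 : ℝ) 2 := by
    rw [show (2 : ENNReal) = ENNReal.ofReal 2 by simp, Metric.eball_ofReal, Real.ball_eq_Ioo]
    constructor <;> linarith [hz.1, hz.2]
  have hdiff {z : ℝ} (hz : z ∈ Ioc (-1) 1) := hF.analyticAt_of_mem (hball hz)
  refine eq_arccos_sq_div_two (fun z hz => (hdiff hz).differentiableAt)
    (fun z hz => (hdiff hz).deriv.differentiableAt) (fun z hz => ?_) ?_ hx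
  · refine (seriesHasSum_chebyshevOp hF (hball hz)).unique ?_
    rw [chebyshevOp_arccosPowSeries_one]
    exact seriesHasSum_one _
  · rw [← hF.coeff_zero 1]
    simp [scalarSeries, constantCoeff_arccosPowSeries_succ 0]

theorem exists_hasFPowerSeriesAt_arccosSqQuotSeries :
    ∃ G : ℝ → ℝ, HasFPowerSeriesAt G (scalarSeries (arccosSqQuotSeries ℝ)) 1 ∧
      arccosSqQuot =ᶠ[𝓝[<] 1] G := by
  obtain ⟨F, hF⟩ := exists_hasFPowerSeriesOnBall_arccosPowSeries_one
  refine ⟨-dslope F 1, ?_, ?_⟩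
  · have hcoeff (n : ℕ) : (-(scalarSeries (arccosPowSeries ℝ 1)).fslope).coeff n =
        coeff n (arccosSqQuotSeries ℝ) := by
      have hneg (p : FormalMultilinearSeries ℝ ℝ ℝ) : (-p).coeff n = -p.coeff n := rfl
      rw [hneg, FormalMultilinearSeries.coeff_fslope, coeff_scalarSeries, arccosSqQuotSeries,
        coeff_mk]
    exact eq_scalarSeries hcoeff ▸ hF.hasFPowerSeriesAt.has_fpower_series_dslope_fslope.neg
  · filter_upwards [Ioo_mem_nhdsLT (by norm_num : (-1 : ℝ) < 1)] with x hx
    have h1 := eq_arccos_sq_of_hasFPowerSeriesOnBall hF (x := 1) (by simp)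
    rw [Pi.neg_apply, dslope_of_ne _ hx.2.ne, slope_def_field, h1,
      eq_arccos_sq_of_hasFPowerSeriesOnBall hF ⟨hx.1, hx.2.le⟩, arccosSqQuot]
    have : 1 - x ≠ 0 := sub_ne_zero.2 hx.2.ne'
    have : x - 1 ≠ 0 := sub_ne_zero.2 hx.2.ne
    rw [arccos_one]
    field_simp
    ring

theorem contDiffOn_arccosSqQuot : ContDiffOn ℝ ∞ arccosSqQuot (Ioo (-1) 1) := by
  intro x hx
  refine (((contDiffAt_arccos hx.1.ne' hx.2.ne).pow 2).div (by fun_prop) ?_).contDiffWithinAt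
  exact mul_ne_zero two_ne_zero (sub_ne_zero.2 hx.2.ne')

theorem tendsto_iteratedDeriv_arccosSqQuot (n : ℕ) :
    Filter.Tendsto (iteratedDeriv n arccosSqQuot) (𝓝[<] 1)
      (𝓝 (n ! * coeff n (arccosSqQuotSeries ℝ))) := by
  obtain ⟨G, hG, heq⟩ := exists_hasFPowerSeriesAt_arccosSqQuotSeries
  rw [← coeff_scalarSeries, ← iteratedDeriv_eq_factorial_mul_coeff hG]
  exact tendsto_iteratedDeriv_of_eventuallyEq hG.analyticAt heq n

theorem arccosSqQuotDeriv_eq (n : ℕ) :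
    arccosSqQuotDeriv n = n ! * coeff n (arccosSqQuotSeries ℝ) :=
  (tendsto_iteratedDeriv_arccosSqQuot n).limUnder_eq

end Arccos

section BellPolynomials

open PowerSeries

theorem coeff_sum_C_mul_X_pow_pow {R ι : Type*} [CommSemiring R] [Fintype ι] [DecidableEq ι]
    (c : ι → R) (w : ι → ℕ) (k d : ℕ) :
    coeff d ((∑ i, C (c i) * X ^ w i) ^ k) =
      ∑ l ∈ (Finset.piAntidiag Finset.univ k).filter (fun l => ∑ i, w i * l i = d),
        (Nat.multinomial Finset.univ l : R) * ∏ i, c i ^ l i := by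
  rw [Finset.sum_pow_eq_sum_piAntidiag, map_sum, Finset.sum_filter]
  refine Finset.sum_congr rfl fun l _ => ?_
  have hprod : ∏ i, (C (c i) * X ^ w i : R⟦X⟧) ^ l i =
      C (∏ i, c i ^ l i) * X ^ ∑ i, w i * l i := by
    simp only [mul_pow, ← pow_mul, Finset.prod_mul_distrib, Finset.prod_pow_eq_pow_sum, map_prod,
      map_pow]
  rw [hprod, ← map_natCast (C (R := R)), ← mul_assoc, ← map_mul, coeff_C_mul, coeff_X_pow,
    mul_ite, mul_one, mul_zero]
  simp only [eq_comm]

theorem coeff_X_mul_pow_eq_coeff_sum_pow {R : Type*} [CommSemiring R] (f : R⟦X⟧) {m k : ℕ}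
    (hkm : k ≤ m) :
    coeff m ((X * f) ^ k) =
      coeff m ((∑ i : Fin (m - k + 1), C (coeff i f) * X ^ ((i : ℕ) + 1)) ^ k) := by
  have htrunc : (trunc (m - k + 1) f : R⟦X⟧) =
      ∑ i : Fin (m - k + 1), C (coeff i f) * X ^ (i : ℕ) := by
    rw [Fin.sum_univ_eq_sum_range fun i => C (coeff i f) * X ^ i]
    ext d
    simp [coeff_trunc, coeff_X_pow]
  have hX : ∑ i : Fin (m - k + 1), C (coeff i f) * X ^ ((i : ℕ) + 1) =
      X * (trunc (m - k + 1) f : R⟦X⟧) := by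
    simp only [htrunc, Finset.mul_sum, pow_succ', mul_left_comm]
  obtain ⟨d, rfl⟩ := Nat.exists_eq_add_of_le' hkm
  rw [hX, mul_pow, mul_pow, coeff_X_pow_mul, coeff_X_pow_mul, Nat.add_sub_cancel,
    ← coeff_coe_trunc_of_lt d.lt_succ_self, ← trunc_trunc_pow,
    coeff_coe_trunc_of_lt d.lt_succ_self]

theorem partialBell_factorial_mul_coeff {m k : ℕ} (hkm : k ≤ m) (f : ℝ⟦X⟧) :
    partialBell m k (fun n => n ! * coeff n f) =
      (m ! / k ! : ℝ) * coeff m ((f - C (constantCoeff f)) ^ k) := by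
  rw [sub_const_eq_X_mul_shift, coeff_X_mul_pow_eq_coeff_sum_pow _ hkm, coeff_sum_C_mul_X_pow_pow,
    Finset.mul_sum, partialBell]
  refine Finset.sum_congr rfl fun l hl => ?_
  have hk : ∑ i, l i = k := (Finset.mem_piAntidiag.1 (Finset.mem_filter.1 hl).1).1
  have hl0 : (∏ i, ((l i)! : ℝ)) ≠ 0 := Finset.prod_ne_zero_iff.2 fun i _ => by positivity
  have hmult : (Nat.multinomial Finset.univ l : ℝ) = k ! / ∏ i, ((l i)! : ℝ) := by
    rw [eq_div_iff hl0, mul_comm]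
    exact mod_cast (Nat.multinomial_spec Finset.univ l).trans (congrArg Nat.factorial hk)
  have hx (i : ℕ) : ((i + 1)! * coeff (i + 1) f / (i + 1)! : ℝ) = coeff (i + 1) f :=
    mul_div_cancel_left₀ _ (by positivity)
  simp only [coeff_mk, hx]
  rw [hmult]
  field_simp

theorem partialBell_const_mul (m k : ℕ) (c : ℝ) (x : ℕ → ℝ) :
    partialBell m k (fun n => c * x n) = c ^ k * partialBell m k x := by
  rw [partialBell, partialBell, Finset.mul_sum]
  refine Finset.sum_congr rfl fun l hl => ?_
  have hk : ∑ i, l i = k := (Finset.mem_piAntidiag.1 (Finset.mem_filter.1 hl).1).1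
  have hc : c ^ k = ∏ i, c ^ l i := by rw [Finset.prod_pow_eq_pow_sum, hk]
  rw [hc, mul_left_comm, ← Finset.prod_mul_distrib]
  simp only [mul_div_assoc, mul_pow]

end BellPolynomials

section Evaluation

open PowerSeries

theorem bellArg_eq (n : ℕ) :
    bellArg n = (2 * n)‼ / (2 * n + 2)! * ((-1) ^ n * n ! ^ 2) := by
  rw [bellArg, show stirlingQ 2 (2 * n) = _ from stirlingQ_two_mul le_rfl n,
    coeff_centralFactorialPoly_succ_one]

theorem two_mul_bellArg (n : ℕ) : 2 * bellArg n = n ! * coeff n (arccosSqQuotSeries ℝ) := by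
  rw [bellArg_eq, coeff_arccosSqQuotSeries, coeff_centralFactorialPoly_succ_one,
    Nat.doubleFactorial_two_mul]
  push_cast
  ring

theorem factorial_div_factorial_mul_two_pow {K : Type*} [Field K] [CharZero K] {m k : ℕ}
    (hkm : k ≤ m) :
    (m ! / k ! * 2 ^ m : K) = 2 ^ k * (2 * (m - k))‼ * m.choose k := by
  have h2 : (2 : K) ^ m = 2 ^ k * 2 ^ (m - k) := by rw [← pow_add, Nat.add_sub_cancel' hkm]
  have := Nat.factorial_ne_zero (m - k)
  rw [Nat.doubleFactorial_two_mul, Nat.cast_choose K hkm, h2]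
  push_cast
  field_simp

theorem coeff_arccosSqQuotSeries_sub_one_pow {m : ℕ} (hm : m ≠ 0) (k : ℕ) :
    coeff m ((arccosSqQuotSeries ℝ - 1) ^ k) =
      2 ^ m * (-1) ^ k * ∑ j ∈ Finset.Icc 1 k,
        (-1) ^ j * (2 * j)! * k.choose j * (stirlingQ (2 * j) (2 * m) / (2 * j + 2 * m)!) := by
  have hterm (j : ℕ) : coeff m ((-1) ^ (j + k) * arccosSqQuotSeries ℝ ^ j * 1 ^ (k - j) *
      (k.choose j : ℝ⟦X⟧)) =
      (-1) ^ (j + k) * k.choose j * coeff m (arccosSqQuotSeries ℝ ^ j) := by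
    rw [← coeff_C_mul]
    congr 1
    simp only [map_mul, map_pow, map_neg, map_one, map_natCast, one_pow]
    ring
  rw [sub_pow, map_sum, Finset.range_eq_Ico, Finset.sum_eq_sum_Ico_succ_bot k.succ_pos, hterm 0,
    pow_zero, coeff_one, if_neg hm, mul_zero, zero_add, Finset.mul_sum]
  refine Finset.sum_congr rfl fun j hj => ?_
  rw [hterm, coeff_arccosSqQuotSeries_pow, ← stirlingQ_two_mul (Finset.mem_Icc.1 hj).1]
  ring

end Evaluation

theorem theorem5p1 (m k : ℕ) (hk : 1 ≤ k) (hkm : k ≤ m) :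
    -- the derivatives at `1⁻` exist
    (ContDiffOn ℝ ∞ arccosSqQuot (Set.Ioo (-1) 1) ∧
      ∀ n : ℕ, 1 ≤ n →
        Filter.Tendsto (iteratedDeriv n arccosSqQuot) (𝓝[<] (1 : ℝ)) (𝓝 (arccosSqQuotDeriv n))) ∧
    -- the first terms of the explicit sequence of arguments
    (bellArg 1 = -1 / 12 ∧ bellArg 2 = 2 / 45 ∧ bellArg 3 = -3 / 70 ∧ bellArg 4 = 32 / 525 ∧
      bellArg 5 = -80 / 693) ∧
    -- the two evaluations
    partialBell m k arccosSqQuotDeriv = (2 : ℝ) ^ k * partialBell m k bellArg ∧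
    partialBell m k arccosSqQuotDeriv =
      (-2 : ℝ) ^ k * ((2 * (m - k))‼ : ℝ) * (m.choose k : ℝ) *
        ∑ j ∈ Finset.Icc 1 k,
          (-1 : ℝ) ^ j * ((2 * j)! : ℝ) * (k.choose j : ℝ) *
            (stirlingQ (2 * j) (2 * m) / ((2 * j + 2 * m)! : ℝ)) := by
  have hderiv : arccosSqQuotDeriv = fun n => n ! * PowerSeries.coeff n (arccosSqQuotSeries ℝ) :=
    funext arccosSqQuotDeriv_eq
  refine ⟨⟨contDiffOn_arccosSqQuot, fun n _ => ?_⟩, ?_, ?_, ?_⟩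
  · rw [arccosSqQuotDeriv_eq]
    exact tendsto_iteratedDeriv_arccosSqQuot n
  · simp only [bellArg_eq]
    norm_num [Nat.doubleFactorial, Nat.factorial]
  · simp only [hderiv, ← two_mul_bellArg, partialBell_const_mul]
  · rw [hderiv, partialBell_factorial_mul_coeff hkm, constantCoeff_arccosSqQuotSeries, map_one,
      coeff_arccosSqQuotSeries_sub_one_pow (by omega), ← mul_assoc, ← mul_assoc,
      factorial_div_factorial_mul_two_pow hkm, neg_pow 2 k]
    ring
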